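/- Let $F$ be Thompson's group, given by the presentation $$F=\langle x_0,x_1,x_2,\dots \;:\; x_i^{-1}x_jx_i=x_{j+1}\ (i<j)\rangle .$$ Let $A$ be the subgroup of $F$ generated by $\{x_{2n+1}x_{2n}^{-1} : n\ge 0\}$ and, for $m\ge 0$, let $A_m$ be the subgroup of $A$ generated by $\{x_{2n+1}x_{2n}^{-1} : n\ge m\}$. Let $F_0$ be the subgroup of $F$ consisting of the elements which can be expressed as words in the $x_i^{\pm1}$ of even exponent sum. Write $A^g=g^{-1}Ag$, and let $\mathcal S$ be the set of all intersections $\bigcap_{g\in X}A^g$ with $X$ a nonempty finite subset of $F_0$. Then: (i) $x_1x_0^{-1},\,x_3x_2^{-1},\,x_5x_4^{-1},\dots$ is a sequence of distinct elements of $F$, and $A$ is a free abelian group with these elements as a basis. (ii) For every finite subset $X$ of $F_0$ there is an $m\ge 0$ such that $A_m\subseteq\bigcap_{g\in X}A^g$. (iii) Every member of $\mathcal S$ is free abelian of infinite rank. (iv) $H^n(F,\mathbb ZF)=0$ for all $n\ge 0$. -/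

import Mathlib

namespace Thompson

/-- The relators `xᵢ⁻¹ xⱼ xᵢ xⱼ₊₁⁻¹`, for `i < j`, of Thompson's group `F` in the free group on
`x₀, x₁, x₂, …`. -/
def relators : Set (FreeGroup ℕ) :=
  {r | ∃ i j : ℕ, i < j ∧
    r = (FreeGroup.of i)⁻¹ * FreeGroup.of j * FreeGroup.of i * (FreeGroup.of (j + 1))⁻¹}

/-- Thompson's group `F = ⟨x₀, x₁, x₂, … : xᵢ⁻¹ xⱼ xᵢ = xⱼ₊₁ (i < j)⟩`. -/
abbrev F : Type := PresentedGroup relators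

/-- The generator `xᵢ` of `F`. -/
def x (i : ℕ) : F := PresentedGroup.of i

/-- The element `x₂ₙ₊₁ x₂ₙ⁻¹` of `F`. -/
def a (n : ℕ) : F := x (2 * n + 1) * (x (2 * n))⁻¹

/-- The subgroup `A` of `F` generated by all `x₂ₙ₊₁ x₂ₙ⁻¹`, `n ≥ 0`. -/
def A : Subgroup F := Subgroup.closure (Set.range a)

/-- The subgroup `A_m` of `F` generated by all `x₂ₙ₊₁ x₂ₙ⁻¹` with `n ≥ m`. -/
def Atail (m : ℕ) : Subgroup F := Subgroup.closure (a '' Set.Ici m)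

/-- The exponent sum of a word in the letters `xᵢ^{±1}`, as a homomorphism to the
(multiplicatively written) integers. -/
def exponentSum : FreeGroup ℕ →* Multiplicative ℤ :=
  FreeGroup.lift fun _ => Multiplicative.ofAdd 1

/-- The words of even exponent sum, as a subgroup of the free group on `x₀, x₁, …`. -/
def evenWords : Subgroup (FreeGroup ℕ) where
  carrier := {w | Even (exponentSum w).toAdd}
  one_mem' := by simp
  mul_mem' hv hw := by
    simp only [Set.mem_ofPred_eq, map_mul, toAdd_mul] at *
    exact hv.add hw
  inv_mem' hw := by
    simp only [Set.mem_ofPred_eq, map_inv, toAdd_inv] at *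
    exact hw.neg

/-- The subgroup `F₀` of `F` of the elements which can be expressed by a word of even
exponent sum. -/
def F₀ : Subgroup F := evenWords.map (PresentedGroup.mk relators)

/-- The conjugate `H^g = g⁻¹ H g`. -/
def conjugate {G : Type*} [Group G] (H : Subgroup G) (g : G) : Subgroup G :=
  H.map (MulAut.conj g⁻¹).toMonoidHom

/-- The family of all finite intersections `⋂_{g ∈ X} A^g` of conjugates of `A`, where `X` is a
nonempty finite subset of `F₀`. -/
def family : Set (Subgroup F) :=
  {H | ∃ X : Finset F, X.Nonempty ∧ (∀ g ∈ X, g ∈ F₀) ∧ H = ⨅ g ∈ X, conjugate A g}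

/-- The group `G` is free abelian of infinite rank: it is isomorphic to the direct sum of copies
of `ℤ` indexed by some infinite set. -/
def IsFreeAbelianOfInfiniteRank (G : Type) [Group G] : Prop :=
  ∃ ι : Type, Infinite ι ∧ Nonempty (G ≃* Multiplicative (ι →₀ ℤ))

end Thompson

/-! Let F act on the line by piecewise linear maps. The element `a n` moves only points of (2n,
2n+2), so evaluation at the midpoints 2n+1 detects every exponent; with commutativity from the
relations, `A` is free abelian on the `a n`. A word of exponent sum e conjugates `x i` to `x (i+e)`
for large i (`exists_conj_x`), so an element of `F₀` preserves the pairing of 2n with 2n+1 and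
carries `a n` to `a (n+c)` for large n. Hence finite intersections of conjugates contain a tail of
`A`. Each embeds in `A`, so it is free abelian, and the tail makes its rank infinite.

For cohomology, `subsingleton_of_stabilizers` reduces vanishing for a group to vanishing for a
family of subgroups closed under intersection with point stabilizers. It passes from F to `F₀`, then
from `F₀` to commutative subgroups containing a tail. Over such a subgroup ℤF is a permutation
module on which a central free abelian group of infinite rank acts freely. Each central basis
element z acts trivially on cohomology, so 0 → ℤY → ℤY → ℤ[Y/z] → 0, with first map z - 1, lowers
the degree by one; infinitely many basis elements serve all degrees (`subsingleton_permutation`). -/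

open CategoryTheory

namespace Rep

universe u
variable {k G : Type u} [CommRing k] [Group G]

theorem shortExact_of_injective_surjective (S : ShortComplex (Rep.{u} k G))
    (hf : Function.Injective S.f.hom) (hg : Function.Surjective S.g.hom)
    (h : ∀ y, S.g.hom y = 0 → ∃ x, S.f.hom x = y) : S.ShortExact where
  exact := by
    rw [← ShortComplex.exact_map_iff_of_faithful S (forget₂ (Rep k G) (ModuleCat k)),
      ShortComplex.moduleCat_exact_iff]
    exact h
  mono_f := (mono_iff_injective _).2 hf
  epi_g := (epi_iff_surjective _).2 hg

theorem exists_of_shortExact {S : ShortComplex (Rep.{u} k G)} (hS : S.ShortExact) (y : S.X₂)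
    (hy : S.g.hom y = 0) : ∃ x, S.f.hom x = y := by
  have := hS.exact
  rw [← ShortComplex.exact_map_iff_of_faithful S (forget₂ (Rep k G) (ModuleCat k)),
      ShortComplex.moduleCat_exact_iff] at this
  exact this y hy

end Rep

/-! ### Vanishing along long exact sequences, and in terms of cochains -/

namespace groupCohomology

universe u
variable {k G : Type u} [CommRing k] [Group G]

theorem subsingleton_iff_isZero (A : Rep.{u} k G) (n : ℕ) :
    Subsingleton (groupCohomology A n) ↔ Limits.IsZero (groupCohomology A n) :=
  (ModuleCat.isZero_iff_subsingleton).symm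

theorem subsingleton_of_iso {A B : Rep.{u} k G} (e : A ≅ B) (n : ℕ)
    [h : Subsingleton (groupCohomology A n)] : Subsingleton (groupCohomology B n) := by
  rw [subsingleton_iff_isZero] at *
  exact h.of_iso ((functor k G n).mapIso e.symm)

variable {S : ShortComplex (Rep.{u} k G)} (hS : S.ShortExact)
include hS

theorem subsingleton_X₃ (n : ℕ) [h₂ : Subsingleton (groupCohomology S.X₂ n)]
    [h₁ : Subsingleton (groupCohomology S.X₁ (n + 1))] :
    Subsingleton (groupCohomology S.X₃ n) := by
  rw [subsingleton_iff_isZero] at *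
  exact (mapShortComplex₃_exact hS (rfl : n + 1 = n + 1)).isZero_of_both_zeros
    (h₂.eq_of_src _ _) (h₁.eq_of_tgt _ _)

theorem subsingleton_X₁_succ (n : ℕ) [h₃ : Subsingleton (groupCohomology S.X₃ n)]
    [h₂ : Subsingleton (groupCohomology S.X₂ (n + 1))] :
    Subsingleton (groupCohomology S.X₁ (n + 1)) := by
  rw [subsingleton_iff_isZero] at *
  exact (mapShortComplex₁_exact hS (rfl : n + 1 = n + 1)).isZero_of_both_zeros
    (h₃.eq_of_src _ _) (h₂.eq_of_tgt _ _)

theorem subsingleton_X₁_zero [h₂ : Subsingleton (groupCohomology S.X₂ 0)] :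
    Subsingleton (groupCohomology S.X₁ 0) := by
  have := hS.mono_f
  rw [subsingleton_iff_isZero] at *
  exact (Limits.IsZero.of_mono (map (MonoidHom.id G) S.f 0) h₂)

omit hS

theorem subsingleton_zero_iff (A : Rep.{u} k G) :
    Subsingleton (groupCohomology A 0) ↔ ∀ v : A, (∀ g, A.ρ g v = v) → v = 0 := by
  rw [((H0Iso A).toLinearEquiv.toEquiv).subsingleton_congr]
  constructor
  · intro h v hv
    exact congrArg Subtype.val (Subsingleton.elim (⟨v, hv⟩ : A.ρ.invariants) 0)
  · intro h
    exact ⟨fun v w => Subtype.ext ((h v.1 v.2).trans (h w.1 w.2).symm)⟩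

theorem subsingleton_succ_iff (A : Rep.{u} k G) (n : ℕ) :
    Subsingleton (groupCohomology A (n + 1)) ↔ ∀ f : (Fin (n + 1) → G) → A,
      inhomogeneousCochains.d A (n + 1) f = 0 →
        ∃ h : (Fin n → G) → A, inhomogeneousCochains.d A n h = f := by
  rw [subsingleton_iff_isZero]
  rw [show groupCohomology A (n + 1) = (inhomogeneousCochains A).homology (n + 1) from rfl]
  rw [← HomologicalComplex.exactAt_iff_isZero_homology,
    HomologicalComplex.exactAt_iff' _ n (n + 1) (n + 2) (by simp) (by simp),
    ShortComplex.moduleCat_exact_iff]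
  rw [← inhomogeneousCochains.d_def, ← inhomogeneousCochains.d_def]
  exact Iff.rfl

end groupCohomology

namespace groupCohomology

universe u
variable {k G : Type u} [CommRing k] [Group G]

theorem hom_d_apply {A B : Rep.{u} k G} (p : A ⟶ B) (n : ℕ) (f : (Fin n → G) → A)
    (g : Fin (n + 1) → G) :
    p.hom (inhomogeneousCochains.d A n f g) =
      inhomogeneousCochains.d B n (fun s => p.hom (f s)) g := by
  simp [inhomogeneousCochains.d_hom_apply, Rep.hom_comm_apply]

/-- Cohomology vanishes on a representation that is a product of representations on which it
vanishes. -/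
theorem subsingleton_of_product {ι : Type*} {N : Rep.{u} k G} {C : ι → Rep.{u} k G}
    (p : ∀ i, N ⟶ C i) (hinj : ∀ v w : N, (∀ i, (p i).hom v = (p i).hom w) → v = w)
    (hsurj : ∀ c : ∀ i, C i, ∃ v : N, ∀ i, (p i).hom v = c i) (n : ℕ)
    (h : ∀ i, Subsingleton (groupCohomology (C i) n)) : Subsingleton (groupCohomology N n) := by
  cases n with
  | zero =>
    simp only [subsingleton_zero_iff] at h ⊢
    intro v hv
    refine hinj _ _ fun i => ?_
    rw [h i ((p i).hom v) fun g => by rw [← Rep.hom_comm_apply, hv], map_zero]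
  | succ n =>
    simp only [subsingleton_succ_iff] at h ⊢
    intro f hf
    have key : ∀ i, ∃ c : (Fin n → G) → C i,
        inhomogeneousCochains.d (C i) n c = fun s => (p i).hom (f s) := by
      intro i
      refine h i _ (funext fun g => ?_)
      rw [← hom_d_apply, hf]
      exact map_zero _
    -- Primitives are chosen in each factor and assembled into one cochain with values in the
    -- product.
    choose c hc using key
    choose b hb using fun s => hsurj fun i => c i s
    refine ⟨b, funext fun g => hinj _ _ fun i => ?_⟩
    rw [hom_d_apply]
    simp only [hb]
    exact congrFun (hc i) g

end groupCohomology

/-! ### Function modules and Shapiro's lemma -/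

namespace Rep

universe u
variable {k G : Type u} [CommRing k] [Group G]

/-- The representation of `G` on the functions from a `G`-set `X` to a representation `M`, with
`(g • f) x = g • f (g⁻¹ • x)`. -/
noncomputable def functions (X : Type u) [MulAction G X] (M : Rep.{u} k G) : Rep.{u} k G :=
  Rep.of (X := X → M)
    { toFun := fun g =>
        { toFun := fun f x => M.ρ g (f (g⁻¹ • x))
          map_add' := fun f f' => by ext x; simp
          map_smul' := fun r f => by ext x; simp }
      map_one' := by ext f x; simp
      map_mul' := fun g h => by ext f x; simp [mul_smul] }

variable (X : Type u) [MulAction G X]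

/-- Postcomposition with a morphism of representations. -/
noncomputable def functionsMap {M N : Rep.{u} k G} (p : M ⟶ N) : functions X M ⟶ functions X N :=
  Rep.ofHom (LinearMap.intertwiningMap_of_isIntertwiningMap _ _ (p.hom.toLinearMap.compLeft X)
    fun g f => by
      ext x
      exact hom_comm_apply p g (f (g⁻¹ • x)))

/-- The constant functions. -/
noncomputable def toFunctions (M : Rep.{u} k G) : M ⟶ functions X M :=
  Rep.ofHom (LinearMap.intertwiningMap_of_isIntertwiningMap _ _ (LinearMap.pi fun _ => LinearMap.id)
    fun _ _ => rfl)

/-- Evaluation along the orbit of a point, with values in a coinduced representation. -/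
noncomputable def functionsToCoind (M : Rep.{u} k G) (x : X) :
    functions X M ⟶ coind (MulAction.stabilizer G x).subtype
      (res (MulAction.stabilizer G x).subtype M) :=
  Rep.ofHom (LinearMap.intertwiningMap_of_isIntertwiningMap _ _
    (LinearMap.codRestrict _
      (LinearMap.pi fun g => (M.ρ g).comp (LinearMap.proj (R := k) (φ := fun _ : X => M) (g⁻¹ • x)))
      fun f s g => by
        have hs : (s : G)⁻¹ • x = x := (s⁻¹).2
        simp [mul_smul, hs])
    fun g f => by
      ext h
      change M.ρ h (M.ρ g (f (g⁻¹ • h⁻¹ • x))) = M.ρ (h * g) (f ((h * g)⁻¹ • x))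
      simp [mul_smul])

theorem functionsToCoind_apply (M : Rep.{u} k G) (x : X) (f : X → M) (g : G) :
    ((functionsToCoind X M x).hom f).1 g = M.ρ g (f (g⁻¹ • x)) := rfl

end Rep

namespace groupCohomology

universe u
variable {k G : Type u} [CommRing k] [Group G] (X : Type u) [MulAction G X]

open Rep

/-- Shapiro's lemma for functions on a `G`-set, as a vanishing criterion. -/
theorem subsingleton_functions (M : Rep.{u} k G) (n : ℕ)
    (h : ∀ x : X, Subsingleton (groupCohomology (res (MulAction.stabilizer G x).subtype M) n)) :
    Subsingleton (groupCohomology (functions X M) n) := by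
  have hx : ∀ x : X, ∃ g : G,
      g⁻¹ • (Quotient.out (Quotient.mk (MulAction.orbitRel G X) x)) = x := by
    intro x
    obtain ⟨g, hg⟩ := Quotient.exact (s := MulAction.orbitRel G X)
      (Quotient.out_eq (Quotient.mk (MulAction.orbitRel G X) x)).symm
    exact ⟨g⁻¹, by simpa using hg⟩
  refine subsingleton_of_product (ι := MulAction.orbitRel.Quotient G X)
    (fun q => functionsToCoind X M (Quotient.out q)) ?_ ?_ n ?_
  · intro v w hvw
    funext x
    obtain ⟨g, hg⟩ := hx x
    have : M.ρ g ((v : X → M) (g⁻¹ • _)) = M.ρ g ((w : X → M) (g⁻¹ • _)) :=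
      congrFun (congrArg Subtype.val (hvw (Quotient.mk _ x))) g
    rw [hg] at this
    exact (M.ρ.apply_bijective g).1 this
  · intro c
    choose γ hγ using hx
    refine ⟨fun x => M.ρ (γ x)⁻¹ ((c (Quotient.mk _ x)).1 (γ x)), fun q => Subtype.ext ?_⟩
    funext g
    rw [functionsToCoind_apply]
    have hq : (Quotient.mk (MulAction.orbitRel G X) (g⁻¹ • Quotient.out q)) = q := by
      conv_rhs => rw [← Quotient.out_eq q]
      exact Quotient.sound ⟨g⁻¹, rfl⟩
    have h1 := hγ (g⁻¹ • Quotient.out q)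
    generalize γ (g⁻¹ • Quotient.out q) = t at h1 ⊢
    rw [hq] at h1 ⊢
    -- Both `t⁻¹` and `g⁻¹` carry the representative to the same point; equivariance of `c q`
    -- absorbs the difference.
    have h2 : t * g⁻¹ ∈ MulAction.stabilizer G (Quotient.out q) := by
      rw [MulAction.mem_stabilizer_iff, mul_smul, ← h1, smul_inv_smul]
    have h3 := (c q).2 ⟨t * g⁻¹, h2⟩ g
    simp only [Subgroup.subtype_apply, inv_mul_cancel_right] at h3
    rw [h3]
    change M.ρ g (M.ρ t⁻¹ (M.ρ (t * g⁻¹) _)) = _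
    simp [← Module.End.mul_apply, ← map_mul]
  · intro q
    rw [subsingleton_iff_isZero]
    have := h (Quotient.out q)
    rw [subsingleton_iff_isZero] at this
    exact this.of_iso (coindIso _ n)

end groupCohomology

namespace Rep

universe u
variable {k G : Type u} [CommRing k] [Group G] (X : Type u) [MulAction G X]

/-- The quotient of the functions on `X` by the constant functions. -/
noncomputable def functionsQuotient (M : Rep.{u} k G) : ShortComplex (Rep.{u} k G) :=
  ShortComplex.mk (toFunctions X M) (Limits.cokernel.π (toFunctions X M)) (by simp)

theorem functionsQuotient_shortExact [Nonempty X] (M : Rep.{u} k G) :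
    (functionsQuotient X M).ShortExact where
  exact := ShortComplex.exact_cokernel _
  mono_f := (mono_iff_injective _).2 fun v w h => by
    obtain ⟨x⟩ := ‹Nonempty X›
    exact congrFun h x
  epi_g := by dsimp [functionsQuotient]; infer_instance

theorem functionsMap_shortExact {S : ShortComplex (Rep.{u} k G)} (hS : S.ShortExact) :
    (ShortComplex.mk (functionsMap X S.f) (functionsMap X S.g) (by
      ext f
      exact funext fun x => congr($(S.zero).hom (f x)))).ShortExact := by
  have hf := (mono_iff_injective _).1 hS.mono_f
  have hg := (epi_iff_surjective _).1 hS.epi_g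
  refine shortExact_of_injective_surjective _ ?_ ?_ ?_
  · intro v w h
    exact funext fun x => hf (congrFun h x)
  · intro f
    choose v hv using fun x => hg (f x)
    exact ⟨v, funext hv⟩
  · intro f h
    choose v hv using fun x => exists_of_shortExact hS (f x) (congrFun h x)
    exact ⟨v, funext hv⟩

/-- Currying. -/
noncomputable def functionsProdIso (Y : Type u) [MulAction G Y] (M : Rep.{u} k G) :
    functions (Y × X) M ≅ functions Y (functions X M) :=
  Rep.mkIso (.mk (LinearEquiv.curry k M Y X) fun _ => rfl)

/-- The action of a central element, as an endomorphism of a representation. -/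
noncomputable def centralHom (M : Rep.{u} k G) (z : G) (hz : z ∈ Subgroup.center G) : M ⟶ M :=
  Rep.ofHom (LinearMap.intertwiningMap_of_isIntertwiningMap _ _ (M.ρ z) fun g v => by
    rw [← Module.End.mul_apply, ← Module.End.mul_apply, ← map_mul, ← map_mul,
      Subgroup.mem_center_iff.1 hz])

theorem centralHom_naturality {M N : Rep.{u} k G} (p : M ⟶ N) (z : G)
    (hz : z ∈ Subgroup.center G) : centralHom M z hz ≫ p = p ≫ centralHom N z hz := by
  ext v
  exact hom_comm_apply p z v

end Rep

/-! ### Dimension shifting: stabilizers and central elements -/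

namespace groupCohomology

universe u
variable {k G : Type u} [CommRing k] [Group G]

open Rep

/-- If `X` is a nonempty `G`-set and `𝒦` a family of subgroups which contains the stabilizers of
the points of `X` and is closed under intersecting with them, and if the cohomology of the members
of `𝒦` vanishes on `M`, then so does the cohomology of `G`. -/
theorem subsingleton_of_stabilizers (X : Type u) [MulAction G X] [Nonempty X]
    (𝒦 : Set (Subgroup G)) (hX : ∀ x : X, MulAction.stabilizer G x ∈ 𝒦)
    (h𝒦 : ∀ K ∈ 𝒦, ∀ x : X, K ⊓ MulAction.stabilizer G x ∈ 𝒦) (M : Rep.{u} k G)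
    (hM : ∀ K ∈ 𝒦, ∀ n, Subsingleton (groupCohomology (res K.subtype M) n)) (n : ℕ) :
    Subsingleton (groupCohomology M n) := by
  -- Quantifying over all such `Y` and all degrees makes the property pass to the cokernel of the
  -- constants, so the degree can be lowered repeatedly.
  let W : Rep.{u} k G → Prop := fun N => ∀ (Y : Type u) (_ : MulAction G Y),
    (∀ y : Y, MulAction.stabilizer G y ∈ 𝒦) → ∀ n, Subsingleton (groupCohomology (functions Y N) n)
  have hW : W M := fun Y _ hY n => subsingleton_functions Y M n fun y => hM _ (hY y) n
  have hfun : ∀ N, W N → W (functions X N) := by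
    intro N hN Y _ hY n
    have := hN (Y × X) inferInstance (fun y => by
      have : MulAction.stabilizer G y = MulAction.stabilizer G y.1 ⊓ MulAction.stabilizer G y.2 := by
        ext g
        simp [Prod.ext_iff]
      rw [this]
      exact h𝒦 _ (hY _) _) n
    exact subsingleton_of_iso (functionsProdIso X Y N) n
  have hquot : ∀ N, W N → W (functionsQuotient X N).X₃ := by
    intro N hN Y _ hY n
    have h1 := hN Y _ hY (n + 1)
    have h2 := hfun N hN Y _ hY n
    exact subsingleton_X₃ (functionsMap_shortExact Y (functionsQuotient_shortExact X N)) n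
      (h₂ := h2) (h₁ := h1)
  suffices ∀ n N, W N → Subsingleton (groupCohomology N n) from this n M hW
  intro n
  induction n with
  | zero =>
    intro N hN
    exact subsingleton_X₁_zero (functionsQuotient_shortExact X N) (h₂ := hN X _ hX 0)
  | succ n ih =>
    intro N hN
    exact subsingleton_X₁_succ (functionsQuotient_shortExact X N) n (h₃ := ih _ (hquot N hN))
      (h₂ := hN X _ hX (n + 1))

/-- Translation is free, so Shapiro's lemma reduces to the trivial group. This supplies the acyclic
modules for shifting degrees in `map_centralHom`. -/
theorem subsingleton_functions_self (M : Rep.{u} k G) (n : ℕ) :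
    Subsingleton (groupCohomology (functions G M) (n + 1)) := by
  refine subsingleton_functions G M (n + 1) fun x => ?_
  have : Subsingleton (MulAction.stabilizer G x) := by
    refine ⟨fun a b => Subtype.ext ?_⟩
    have ha : (a : G) * x = x := a.2
    have hb : (b : G) * x = x := b.2
    exact mul_right_cancel (ha.trans hb.symm)
  rw [subsingleton_iff_isZero]
  exact isZero_groupCohomology_succ_of_subsingleton _ n

/-- Central elements act trivially on cohomology. -/
theorem map_centralHom (M : Rep.{u} k G) (z : G) (hz : z ∈ Subgroup.center G) (n : ℕ) :
    map (MonoidHom.id G) (centralHom M z hz) n = 𝟙 _ := by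
  induction n generalizing M with
  | zero =>
    have h : (invariantsFunctor k G).map (centralHom M z hz) = 𝟙 _ :=
      ModuleCat.hom_ext (LinearMap.ext fun v => Subtype.ext (v.2 z))
    rw [← cancel_mono (H0Iso M).hom, map_id_comp_H0Iso_hom, Category.id_comp, h]
    exact Category.comp_id _
  | succ n ih =>
    have hS := functionsQuotient_shortExact G M
    -- The connecting map is onto and commutes with the action of `z`, so triviality in degree n
    -- forces it in degree n + 1.
    have := epi_δ_of_isZero hS n ((subsingleton_iff_isZero _ _).1 (subsingleton_functions_self M n))
    let φ : functionsQuotient G M ⟶ functionsQuotient G M :=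
      { τ₁ := centralHom _ z hz
        τ₂ := centralHom _ z hz
        τ₃ := centralHom _ z hz
        comm₁₂ := centralHom_naturality _ z hz
        comm₂₃ := centralHom_naturality _ z hz }
    have key := δ_naturality hS hS φ n (n + 1) rfl
    rw [show φ.τ₁ = centralHom _ z hz from rfl, show φ.τ₃ = centralHom _ z hz from rfl, ih,
      Category.id_comp] at key
    refine (cancel_epi (δ hS n (n + 1) rfl)).1 ?_
    exact key.trans (Category.comp_id _).symm

/-- A central element which acts without nonzero fixed vectors shifts the vanishing of cohomology
from the coinvariants by one degree. -/
theorem subsingleton_succ_of_central {M N : Rep.{u} k G} (z : G) (hz : z ∈ Subgroup.center G)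
    (p : M ⟶ N) (hp : Function.Surjective p.hom)
    (hz0 : ∀ v : M, M.ρ z v = v → v = 0)
    (hker : ∀ v : M, p.hom v = 0 ↔ ∃ w : M, M.ρ z w - w = v) (n : ℕ)
    (hN : Subsingleton (groupCohomology N n)) : Subsingleton (groupCohomology M (n + 1)) := by
  let S : ShortComplex (Rep.{u} k G) := ShortComplex.mk (centralHom M z hz - 𝟙 M) p (by
    ext v
    exact (hker _).2 ⟨v, rfl⟩)
  have hS : S.ShortExact := by
    refine shortExact_of_injective_surjective _ ?_ hp fun v hv => (hker v).1 hv
    refine (injective_iff_map_eq_zero _).2 fun v hv => hz0 v (sub_eq_zero.1 hv)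
  -- By additivity z - 1 induces the difference of two identity maps.
  have hzero : map (MonoidHom.id G) S.f (n + 1) = 0 := by
    change HomologicalComplex.homologyMap
      ((cochainsFunctor k G).map (centralHom M z hz - 𝟙 M)) (n + 1) = 0
    rw [Functor.map_sub, HomologicalComplex.homologyMap_sub, sub_eq_zero]
    exact (map_centralHom M z hz (n + 1)).trans (map_id _).symm
  rw [subsingleton_iff_isZero] at hN ⊢
  exact (mapShortComplex₁_exact hS (rfl : n + 1 = n + 1)).isZero_of_both_zeros
    (hN.eq_of_src _ _) hzero

end groupCohomology

/-! ### Kernel and cokernel of z - 1 on a permutation module -/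

namespace Finsupp

variable {k G Y : Type*} [Ring k] [Group G] [MulAction G Y]

/-- An invariant function is constant on orbits, which are infinite, while its support is finite. -/
theorem eq_zero_of_mapDomain_smul_eq {z : G} (hz : ∀ (y : Y) (j : ℤ), z ^ j • y = y → j = 0)
    {v : Y →₀ k} (hv : v.mapDomain (z • ·) = v) : v = 0 := by
  have hv' : ∀ y, v (z • y) = v y := by
    intro y
    conv_lhs => rw [← hv]
    exact mapDomain_apply (MulAction.injective z) _ _
  have hvj : ∀ (j : ℕ) y, v (z ^ j • y) = v y := by
    intro j
    induction j with
    | zero => simp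
    | succ j ih => intro y; rw [pow_succ, mul_smul, ih, hv']
  ext y
  by_contra hy
  have hinj : Function.Injective fun j : ℕ => z ^ j • y := by
    intro i j hij
    have hij' : z ^ (i : ℤ) • y = z ^ (j : ℤ) • y := by simpa using hij
    have := hz y (-j + i) (by rw [zpow_add, mul_smul, hij', ← mul_smul, ← zpow_add]; simp)
    lia
  refine Set.infinite_range_of_injective hinj (v.support.finite_toSet.subset ?_)
  rintro _ ⟨j, rfl⟩
  rw [Finset.mem_coe, mem_support_iff, hvj]
  exact hy

theorem mapDomain_eq_zero_iff_of_zpowers {Y' : Type*} {π : Y → Y'} (hsurj : Function.Surjective π)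
    {z : G} (hz : ∀ y y', π y = π y' ↔ ∃ j : ℤ, z ^ j • y' = y) (v : Y →₀ k) :
    v.mapDomain π = 0 ↔ ∃ w : Y →₀ k, w.mapDomain (z • ·) - w = v := by
  -- A telescoping sum moves a point mass along its orbit modulo the image of z - 1.
  have hsingle : ∀ (r : k) (j : ℤ) (y : Y), ∃ w : Y →₀ k,
      w.mapDomain (z • ·) - w = single (z ^ j • y) r - single y r := by
    intro r j
    induction j with
    | zero => exact fun y => ⟨0, by simp⟩
    | succ j ih =>
      intro y
      obtain ⟨w, hw⟩ := ih y
      refine ⟨w + single (z ^ (j : ℤ) • y) r, ?_⟩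
      rw [mapDomain_add, add_sub_add_comm, hw, mapDomain_single, ← mul_smul, ← zpow_one_add,
        add_comm 1]
      abel
    | pred j ih =>
      intro y
      obtain ⟨w, hw⟩ := ih y
      refine ⟨w - single (z ^ (-j - 1 : ℤ) • y) r, ?_⟩
      rw [sub_eq_add_neg w, ← single_neg, mapDomain_add, add_sub_add_comm, hw, mapDomain_single,
        ← mul_smul, ← zpow_one_add, add_sub_cancel, single_neg, single_neg]
      abel
  obtain ⟨s, hs⟩ := hsurj.hasRightInverse
  -- Modulo that image, all mass can be moved to the orbit representatives chosen by `s`.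
  have hall : ∀ v : Y →₀ k, ∃ w : Y →₀ k,
      w.mapDomain (z • ·) - w = v - (v.mapDomain π).mapDomain s := by
    intro v
    induction v using Finsupp.induction_linear with
    | zero => exact ⟨0, by simp⟩
    | add v v' h h' =>
      obtain ⟨w, hw⟩ := h
      obtain ⟨w', hw'⟩ := h'
      refine ⟨w + w', ?_⟩
      rw [mapDomain_add, add_sub_add_comm, hw, hw', mapDomain_add, mapDomain_add]
      exact (add_sub_add_comm _ _ _ _).symm
    | single y r =>
      obtain ⟨j, hj⟩ := (hz y (s (π y))).1 (hs _).symm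
      obtain ⟨w, hw⟩ := hsingle r j (s (π y))
      refine ⟨w, ?_⟩
      rw [hw, hj, mapDomain_single, mapDomain_single]
  constructor
  · intro h
    obtain ⟨w, hw⟩ := hall v
    exact ⟨w, hw.trans (by rw [h]; simp)⟩
  · rintro ⟨w, rfl⟩
    have h : π ∘ (z • ·) = π := funext fun y => (hz (z • y) y).2 ⟨1, by simp⟩
    have := mapDomain_add (f := π) (v₁ := w.mapDomain (z • ·) - w) (v₂ := w)
    rwa [sub_add_cancel, ← mapDomain_comp, h, right_eq_add] at this

end Finsupp

namespace Rep

universe u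
variable (k : Type u) {G : Type u} [CommRing k] [Group G]

/-- The permutation representation on the finitely supported functions on a `G`-set. -/
noncomputable def permutation (Y : Type u) [MulAction G Y] : Rep.{u} k G :=
  Rep.of (X := Y →₀ k)
    { toFun := fun g => Finsupp.lmapDomain k k (g • ·)
      map_one' := by ext; simp
      map_mul' := fun g h => by ext; simp [mul_smul] }

/-- Restrictions of permutation representations are permutation representations. -/
noncomputable def permutationIsoResOfMulAction {H : Type u} [Group H] (f : H →* G) (Y : Type u)
    [MulAction G Y] [MulAction H Y] (hf : ∀ h (y : Y), f h • y = h • y) :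
    permutation k (G := H) Y ≅ res f (ofMulAction k G Y) :=
  Rep.mkIso (.mk (MonoidAlgebra.coeffLinearEquiv k).symm fun h => by
    ext y : 1
    refine LinearMap.ext fun r => ?_
    have h1 := Representation.ofMulAction_single (k := k) (f h) y r
    rw [hf] at h1
    refine Eq.trans ?_ h1.symm
    simp)

variable {k}

/-- The morphism of permutation representations induced by an equivariant map. -/
noncomputable def permutationMap {Y Y' : Type u} [MulAction G Y] [MulAction G Y'] (π : Y → Y')
    (hπ : ∀ (g : G) y, π (g • y) = g • π y) :
    permutation k (G := G) Y ⟶ permutation k (G := G) Y' :=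
  Rep.ofHom (LinearMap.intertwiningMap_of_isIntertwiningMap _ _ (Finsupp.lmapDomain k k π)
    fun g v => by
      change (Finsupp.mapDomain (g • ·) v).mapDomain π =
        (Finsupp.mapDomain π v).mapDomain (g • ·)
      rw [← Finsupp.mapDomain_comp, ← Finsupp.mapDomain_comp]
      exact congrArg (fun f => Finsupp.mapDomain f v) (funext fun y => hπ g y))

end Rep

namespace groupCohomology

open Rep

/-- Cohomology vanishes on the permutation module of a set on which a central free abelian group
of infinite rank acts freely. -/
theorem subsingleton_permutation {G : Type} [Group G] (φ : Multiplicative (ℕ →₀ ℤ) →* G)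
    (hφ : ∀ e, φ e ∈ Subgroup.center G) (Y : Type) [MulAction G Y]
    (hfree : ∀ (y : Y) e, φ e • y = y → e = 1) (n : ℕ) :
    Subsingleton (groupCohomology (permutation ℤ (G := G) Y) n) := by
  have hz : ∀ (φ : Multiplicative (ℕ →₀ ℤ) →* G) (Y : Type) [MulAction G Y],
      (∀ (y : Y) e, φ e • y = y → e = 1) → ∀ (y : Y) (j : ℤ),
        φ (.ofAdd (Finsupp.single 0 1)) ^ j • y = y → j = 0 := by
    intro φ Y _ hfree y j hj
    rw [← map_zpow] at hj
    have := hfree y _ hj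
    rw [← ofAdd_zsmul, ofAdd_eq_one] at this
    simpa using DFunLike.congr_fun this 0
  -- The inductive step replaces `Y` by its quotient by the first basis element and `φ` by its
  -- restriction to the remaining ones.
  induction n generalizing φ Y with
  | zero =>
    rw [subsingleton_zero_iff]
    exact fun v hv => Finsupp.eq_zero_of_mapDomain_smul_eq (hz φ Y hfree) (hv _)
  | succ n ih =>
    set z := φ (.ofAdd (Finsupp.single 0 1)) with hzdef
    have hzc : ∀ g : G, Commute g z := Subgroup.mem_center_iff.1 (hφ _)
    have hsmul : ∀ (g : G) (j : ℤ) (y : Y), g • z ^ j • y = z ^ j • g • y := by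
      intro g j y
      rw [← mul_smul, ← mul_smul, ((hzc g).zpow_right j).eq]
    let Y' := MulAction.orbitRel.Quotient (Subgroup.zpowers z) Y
    have hrel : ∀ y y' : Y, (Quotient.mk _ y : Y') = Quotient.mk _ y' ↔ ∃ j : ℤ, z ^ j • y' = y := by
      intro y y'
      rw [Quotient.eq, MulAction.orbitRel_apply]
      constructor
      · rintro ⟨⟨_, j, rfl⟩, h⟩
        exact ⟨j, h⟩
      · rintro ⟨j, h⟩
        exact ⟨⟨_, j, rfl⟩, h⟩
    let act : MulAction G Y' :=
      { smul := fun g => Quotient.map (g • ·) (by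
          rintro y y' h
          obtain ⟨j, hj⟩ := (hrel y y').1 (Quotient.sound h)
          refine Quotient.exact ((hrel _ _).2 ⟨j, ?_⟩)
          rw [← hsmul, hj])
        one_smul := by
          rintro ⟨y⟩
          exact congrArg (Quotient.mk _) (one_smul G y)
        mul_smul := by
          rintro g h ⟨y⟩
          exact congrArg (Quotient.mk _) (mul_smul g h y) }
    let shift : Multiplicative (ℕ →₀ ℤ) →* Multiplicative (ℕ →₀ ℤ) :=
      AddMonoidHom.toMultiplicative (Finsupp.mapDomain.addMonoidHom Nat.succ)
    have hN := ih (φ.comp shift) (fun e => hφ _) Y' (by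
      rintro ⟨y⟩ e he
      obtain ⟨j, hj⟩ := (hrel _ _).1 he
      -- Fixing an orbit means fixing `y` up to a power of z. That power affects only coordinate 0,
      -- which `shift e` avoids.
      have h1 : φ (shift e * (.ofAdd (Finsupp.single 0 1)) ^ (-j)) • y = y := by
        rw [mul_comm, map_mul, mul_smul, map_zpow, ← hzdef, zpow_neg, inv_smul_eq_iff]
        exact hj.symm
      have h2 := hfree y _ h1
      refine Multiplicative.toAdd.injective (Finsupp.ext fun i => ?_)
      have h3 := DFunLike.congr_fun (congrArg Multiplicative.toAdd h2) (i + 1)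
      have h4 : Finsupp.mapDomain Nat.succ (Multiplicative.toAdd e) (i + 1) = e.toAdd i :=
        Finsupp.mapDomain_apply Nat.succ_injective _ _
      rw [← h4]
      simpa [shift] using h3)
    exact subsingleton_succ_of_central z (hφ _)
      (permutationMap (Quotient.mk _ : Y → Y') fun _ _ => rfl)
      (Finsupp.mapDomain_surjective Quotient.mk_surjective)
      (fun _ hv => Finsupp.eq_zero_of_mapDomain_smul_eq (hz φ Y hfree) hv)
      (Finsupp.mapDomain_eq_zero_iff_of_zpowers Quotient.mk_surjective hrel) n hN

end groupCohomology

/-! ### Relations in F and the action on the line -/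

namespace Thompson

theorem conj_x {i j : ℕ} (h : i < j) : (x i)⁻¹ * x j * x i = x (j + 1) := by
  have := PresentedGroup.one_of_mem (rels := relators) ⟨i, j, h, rfl⟩
  rw [map_mul, map_mul, map_mul, map_inv, map_inv, mul_inv_eq_one] at this
  exact this

/-- Both factors of `a n` come from generators that conjugate `x j` to `x (j + 1)`, so their effects
cancel. -/
theorem commute_a_x {n j : ℕ} (h : 2 * n + 1 < j) : Commute (a n) (x j) := by
  have h0 : x (2 * n) * x (j + 1) = x j * x (2 * n) := by
    rw [← conj_x (show 2 * n < j by lia)]; group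
  have h1 : x (2 * n + 1) * x (j + 1) = x j * x (2 * n + 1) := by
    rw [← conj_x h]; group
  have h2 : (x (2 * n))⁻¹ * x j = x (j + 1) * (x (2 * n))⁻¹ := by
    rw [inv_mul_eq_iff_eq_mul, ← mul_assoc, h0, mul_inv_cancel_right]
  rw [commute_iff_eq, a, mul_assoc, h2, ← mul_assoc, h1, mul_assoc]

theorem commute_a (m n : ℕ) : Commute (a m) (a n) := by
  rcases lt_trichotomy m n with h | rfl | h
  · exact (commute_a_x (by lia)).mul_right (commute_a_x (by lia)).inv_right
  · exact Commute.refl _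
  · exact ((commute_a_x (by lia)).mul_right (commute_a_x (by lia)).inv_right).symm

/-- Conjugation by a word of exponent sum `e` shifts the indices of the late generators by `e`. -/
theorem exists_conj_x (w : FreeGroup ℕ) : ∃ N : ℕ, ∀ i j : ℕ, N ≤ i →
    (j : ℤ) = i + (exponentSum w).toAdd →
      (PresentedGroup.mk relators w)⁻¹ * x i * PresentedGroup.mk relators w = x j := by
  induction w using FreeGroup.induction_on with
  | C1 =>
    refine ⟨0, fun i j _ h => ?_⟩
    obtain rfl : j = i := by simpa using h
    simp
  | of k =>
    refine ⟨k + 1, fun i j hi h => ?_⟩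
    obtain rfl : j = i + 1 := by
      simp only [exponentSum, FreeGroup.lift_apply_of, toAdd_ofAdd] at h
      exact_mod_cast h
    exact conj_x (by lia)
  | inv_of k _ =>
    refine ⟨k + 2, fun i j hi h => ?_⟩
    obtain rfl : i = j + 1 := by
      simp only [exponentSum, map_inv, FreeGroup.lift_apply_of, toAdd_inv, toAdd_ofAdd] at h
      lia
    rw [← conj_x (show k < j by lia), map_inv]
    change (x k)⁻¹⁻¹ * _ * (x k)⁻¹ = _
    group
  | mul v w hv hw =>
    obtain ⟨N, hN⟩ := hv
    obtain ⟨N', hN'⟩ := hw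
    -- The last summand keeps the intermediate index, reached after conjugating by `v`, at least
    -- `N'`.
    refine ⟨N + N' + (exponentSum v).toAdd.natAbs, fun i j hi h => ?_⟩
    rw [map_mul, toAdd_mul] at h
    obtain ⟨l, hl⟩ := Int.eq_ofNat_of_zero_le (a := i + (exponentSum v).toAdd) (by lia)
    rw [map_mul, ← hN' l j (by lia) (by lia), ← hN i l (by lia) hl.symm]
    group

/-- The piecewise linear homeomorphism of the line with slope `2` on `[j, j + 1]`, which is the
identity on the left and the translation by `1` on the right of this interval. -/
def dilation (j : ℕ) : Equiv.Perm ℚ where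
  toFun t := max t (min (2 * t - j) (t + 1))
  invFun s := min s (max ((s + j) / 2) (s - 1))
  left_inv t := by grind
  right_inv t := by grind

theorem dilation_apply (j : ℕ) (t : ℚ) :
    dilation j t = max t (min (2 * t - j) (t + 1)) := rfl

theorem dilation_inv_apply (j : ℕ) (t : ℚ) :
    (dilation j)⁻¹ t = min t (max ((t + j) / 2) (t - 1)) := rfl

/-- `dilation i` is translation by 1 to the right of `i + 1`, a region containing everything that
`dilation j` moves. -/
theorem dilation_mul {i j : ℕ} (h : i < j) :
    dilation i * dilation j = dilation (j + 1) * dilation i := by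
  ext t
  have h' : (i : ℚ) + 1 ≤ j := by exact_mod_cast h
  simp only [Equiv.Perm.mul_apply, dilation_apply, Nat.cast_add, Nat.cast_one]
  grind

/-- The action of Thompson's group on the line by piecewise linear homeomorphisms. -/
noncomputable def toPerm : F →* Equiv.Perm ℚ :=
  PresentedGroup.toGroup (f := fun j => (dilation j)⁻¹) (by
    rintro _ ⟨i, j, h, rfl⟩
    simp only [map_mul, map_inv, FreeGroup.lift_apply_of, inv_inv]
    rw [eq_mul_inv_of_mul_eq (dilation_mul h).symm]
    group)

theorem toPerm_x (j : ℕ) : toPerm (x j) = (dilation j)⁻¹ := PresentedGroup.toGroup.of _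

theorem toPerm_a_apply (n : ℕ) (t : ℚ) :
    toPerm (a n) t = (dilation (2 * n + 1))⁻¹ (dilation (2 * n) t) := by
  simp [a, toPerm_x]

theorem toPerm_a_apply_of_not_mem {n : ℕ} {t : ℚ} (h : t ≤ 2 * n ∨ 2 * n + 2 ≤ t) :
    toPerm (a n) t = t := by
  rw [toPerm_a_apply, dilation_apply, dilation_inv_apply]
  push_cast
  grind

theorem toPerm_a_apply_of_mem {n : ℕ} {t : ℚ} (h₁ : 2 * n < t) (h₂ : t < 2 * n + 2) :
    t < toPerm (a n) t ∧ toPerm (a n) t < 2 * n + 2 := by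
  rw [toPerm_a_apply, dilation_apply, dilation_inv_apply]
  push_cast
  grind

theorem toPerm_a_pow_apply_of_mem {n : ℕ} (j : ℕ) {t : ℚ} (h₁ : 2 * n < t) (h₂ : t < 2 * n + 2) :
    t < toPerm (a n ^ (j + 1)) t ∧ toPerm (a n ^ (j + 1)) t < 2 * n + 2 := by
  induction j with
  | zero => simpa using toPerm_a_apply_of_mem h₁ h₂
  | succ j ih =>
    have := toPerm_a_apply_of_mem (h₁.trans ih.1) ih.2
    rw [pow_succ', map_mul, Equiv.Perm.mul_apply]
    exact ⟨ih.1.trans this.1, this.2⟩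

theorem toPerm_a_zpow_apply_ne (n : ℕ) {j : ℤ} (hj : j ≠ 0) :
    toPerm (a n ^ j) (2 * n + 1) ≠ 2 * n + 1 := by
  have key : ∀ i : ℕ, toPerm (a n ^ (i + 1)) (2 * n + 1) ≠ 2 * n + 1 := fun i =>
    (toPerm_a_pow_apply_of_mem i (by linarith) (by linarith)).1.ne'
  obtain ⟨i, hi⟩ := Nat.exists_eq_succ_of_ne_zero (Int.natAbs_ne_zero.2 hj)
  rcases Int.natAbs_eq j with h | h
  · rw [h, hi, zpow_natCast]
    exact key i
  · rw [h, hi, zpow_neg, zpow_natCast, map_inv, Ne, Equiv.Perm.inv_eq_iff_eq]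
    exact (key i).symm

theorem a_mem_A (n : ℕ) : a n ∈ A := Subgroup.subset_closure ⟨n, rfl⟩

instance : IsMulCommutative A := Subgroup.isMulCommutative_closure (by
    rintro _ ⟨m, rfl⟩ _ ⟨n, rfl⟩
    exact commute_a m n)

end Thompson

/-! ### `A` is free abelian, and its conjugates share tails -/

namespace Thompson

/-- The homomorphism from the free abelian group on `ℕ` to `A` sending the `n`-th basis element
to `a n`. -/
noncomputable def aHom : Multiplicative (ℕ →₀ ℤ) →* A :=
  letI : CommGroup A := { mul_comm := mul_comm' }
  AddMonoidHom.toMultiplicativeLeft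
    (Finsupp.liftAddHom fun n => zmultiplesHom (Additive A) (Additive.ofMul ⟨a n, a_mem_A n⟩))

theorem aHom_single (n : ℕ) (j : ℤ) : (aHom (.ofAdd (Finsupp.single n j)) : F) = a n ^ j := by
  simp [aHom]

theorem aHom_add (e f : ℕ →₀ ℤ) :
    (aHom (.ofAdd (e + f)) : F) = aHom (.ofAdd e) * aHom (.ofAdd f) := by
  rw [ofAdd_add, map_mul, Subgroup.coe_mul]

theorem toPerm_aHom_apply (e : ℕ →₀ ℤ) (n : ℕ) (hn : e n = 0) :
    toPerm (aHom (.ofAdd e)) (2 * n + 1) = 2 * n + 1 := by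
  induction e using Finsupp.induction with
  | zero => simp
  | single_add m j f hm hj ih =>
    have hmn : m ≠ n := by
      rintro rfl
      rw [Finsupp.notMem_support_iff] at hm
      simp [hm] at hn
      exact hj hn
    rw [aHom_add, aHom_single, map_mul, Equiv.Perm.mul_apply, ih (by simpa [hmn] using hn)]
    have h1 : toPerm (a m) ∈ MulAction.stabilizer (Equiv.Perm ℚ) (2 * n + 1 : ℚ) := by
      refine toPerm_a_apply_of_not_mem ?_
      rcases hmn.lt_or_gt with h | h
      · right
        have : (m : ℚ) + 1 ≤ n := by exact_mod_cast h
        linarith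
      · left
        have : (n : ℚ) + 1 ≤ m := by exact_mod_cast h
        linarith
    rw [map_zpow]
    exact Subgroup.zpow_mem _ h1 j

theorem aHom_injective : Function.Injective aHom := by
  refine (injective_iff_map_eq_one _).2 fun e he => ?_
  refine Multiplicative.toAdd.injective (Finsupp.ext fun n => ?_)
  by_contra hn
  refine toPerm_a_zpow_apply_ne n hn ?_
  -- The part of `e` away from `n` fixes the midpoint 2n+1, so only the power of `a n` acts there.
  have h := aHom_add (Finsupp.single n (e.toAdd n)) (e.toAdd.erase n)
  rw [Finsupp.single_add_erase, aHom_single, ofAdd_toAdd, he] at h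
  have h' := congrArg (fun g => toPerm g (2 * n + 1)) h
  simp only [map_mul, Equiv.Perm.mul_apply, toPerm_aHom_apply _ n Finsupp.erase_same] at h'
  rw [← h']
  simp

theorem aHom_surjective : Function.Surjective aHom := by
  have h : A ≤ (A.subtype.comp aHom).range := by
    refine (Subgroup.closure_le _).2 ?_
    rintro _ ⟨n, rfl⟩
    exact ⟨.ofAdd (Finsupp.single n 1), by simpa using aHom_single n 1⟩
  intro g
  obtain ⟨e, he⟩ := h g.2
  exact ⟨e, Subtype.ext he⟩

/-- The group `A` is free abelian with basis `a`. -/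
noncomputable def aEquiv : Multiplicative (ℕ →₀ ℤ) ≃* A :=
  MulEquiv.ofBijective aHom ⟨aHom_injective, aHom_surjective⟩

theorem aEquiv_single (n : ℕ) : (aEquiv (.ofAdd (Finsupp.single n 1)) : F) = a n := by
  exact (aHom_single n 1).trans (zpow_one _)

theorem a_injective : Function.Injective a := by
  intro m n h
  rw [← aEquiv_single m, ← aEquiv_single n] at h
  have := Multiplicative.ofAdd.injective (aEquiv.injective (Subtype.ext h))
  exact Finsupp.single_left_injective one_ne_zero this

theorem Atail_antitone {m n : ℕ} (h : m ≤ n) : Atail n ≤ Atail m :=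
  Subgroup.closure_mono (Set.image_mono (Set.Ici_subset_Ici.2 h))

/-- The translation of the basis of the free abelian group on `ℕ`. -/
noncomputable def shift (m : ℕ) : Multiplicative (ℕ →₀ ℤ) →* Multiplicative (ℕ →₀ ℤ) :=
  AddMonoidHom.toMultiplicative (Finsupp.mapDomain.addMonoidHom (· + m))

theorem shift_injective (m : ℕ) : Function.Injective (shift m) :=
  Finsupp.mapDomain_injective (add_left_injective m)

theorem aHom_shift_mem (m : ℕ) (e : Multiplicative (ℕ →₀ ℤ)) :
    (aHom (shift m e) : F) ∈ Atail m := by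
  suffices ∀ e : ℕ →₀ ℤ, (aHom (.ofAdd (e.mapDomain (· + m))) : F) ∈ Atail m from this e.toAdd
  intro e
  induction e using Finsupp.induction_linear with
  | zero => simp
  | add e f he hf =>
    rw [Finsupp.mapDomain_add, aHom_add]
    exact mul_mem he hf
  | single n j =>
    rw [Finsupp.mapDomain_single, aHom_single]
    have h : a (n + m) ∈ Atail m := Subgroup.subset_closure ⟨n + m, Nat.le_add_left m n, rfl⟩
    exact zpow_mem h j

theorem mem_conjugate {G : Type*} [Group G] {H : Subgroup G} {g h : G} :
    h ∈ conjugate H g ↔ g * h * g⁻¹ ∈ H := by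
  simp only [conjugate, Subgroup.mem_map]
  constructor
  · rintro ⟨y, hy, rfl⟩
    simpa [mul_assoc] using hy
  · intro hh
    exact ⟨_, hh, by simp [mul_assoc]⟩

theorem exists_Atail_le_conjugate {g : F} (hg : g ∈ F₀) : ∃ m, Atail m ≤ conjugate A g := by
  obtain ⟨w, hw, rfl⟩ := hg
  -- Lying in the conjugate by g means g h g⁻¹ ∈ `A`, so the word to conjugate by is `w⁻¹`. The
  -- shift 2c preserves parity, giving `a (n + c)`.
  obtain ⟨c, hc⟩ : Even (exponentSum w⁻¹).toAdd := evenWords.inv_mem hw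
  obtain ⟨N, hN⟩ := exists_conj_x w⁻¹
  refine ⟨N + c.natAbs, (Subgroup.closure_le _).2 ?_⟩
  rintro _ ⟨n, hn, rfl⟩
  rw [Set.mem_Ici] at hn
  obtain ⟨l, hl⟩ := Int.eq_ofNat_of_zero_le (a := n + c) (by lia)
  refine mem_conjugate.2 ?_
  have h0 := hN (2 * n) (2 * l) (by lia) (by rw [hc]; push_cast; lia)
  have h1 := hN (2 * n + 1) (2 * l + 1) (by lia) (by rw [hc]; push_cast; lia)
  rw [map_inv, inv_inv] at h0 h1
  have : PresentedGroup.mk relators w * a n * (PresentedGroup.mk relators w)⁻¹ = a l := by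
    rw [a, a, ← h0, ← h1]
    group
  rw [this]
  exact a_mem_A l

theorem exists_Atail_le_iInf (X : Finset F) (hX : ∀ g ∈ X, g ∈ F₀) :
    ∃ m, Atail m ≤ ⨅ g ∈ X, conjugate A g := by
  choose! m hm using fun g (hg : g ∈ X) => exists_Atail_le_conjugate (hX g hg)
  exact ⟨X.sup m, le_iInf₂ fun g hg => (Atail_antitone (Finset.le_sup hg)).trans (hm g hg)⟩

end Thompson

/-- Submodules of free modules of any rank over a principal ideal ring without zero divisors are
free. -/
theorem Submodule.free_of_isPrincipalIdealRing {R ι : Type*} [CommRing R] [IsDomain R]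
    [IsPrincipalIdealRing R] [LinearOrder ι] [WellFoundedLT ι] (N : Submodule R (ι →₀ R)) :
    Module.Free R N := by
  let V : ι → Submodule R (ι →₀ R) := fun i =>
    { carrier := {v | v ∈ N ∧ ∀ j, i < j → v j = 0}
      zero_mem' := ⟨N.zero_mem, by simp⟩
      add_mem' := fun hv hw => ⟨N.add_mem hv.1 hw.1, fun j hj => by
        rw [Finsupp.add_apply, hv.2 j hj, hw.2 j hj, add_zero]⟩
      smul_mem' := fun c v hv => ⟨N.smul_mem c hv.1, fun j hj => by
        rw [Finsupp.smul_apply, hv.2 j hj, smul_zero]⟩ }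
  obtain ⟨b, hb, hdiv⟩ : ∃ b : ι → ι →₀ R, (∀ i, b i ∈ V i) ∧
      ∀ i, ∀ v ∈ V i, ∃ c : R, v i = c * b i i := by
    -- `I i` is the ideal of possible leading coefficients at `i`; `b i` realizes a generator.
    let I : ι → Ideal R := fun i => (V i).map (Finsupp.lapply i)
    choose b hb hbd using fun i => Submodule.mem_map.1 (Submodule.IsPrincipal.generator_mem (I i))
    refine ⟨b, hb, fun i v hv => ?_⟩
    have : v i ∈ I i := Submodule.mem_map.2 ⟨v, hv, rfl⟩
    obtain ⟨c, hc⟩ := (Submodule.IsPrincipal.mem_iff_eq_smul_generator (I i)).1 this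
    exact ⟨c, by rw [hc, ← hbd i]; rfl⟩
  let β : {i // b i i ≠ 0} → ι →₀ R := fun i => b i
  have hli : LinearIndependent R β := by
    refine linearIndependent_iff.2 fun l hl => ?_
    by_contra hne
    have hs : l.support.Nonempty := Finsupp.support_nonempty_iff.2 hne
    set m := l.support.max' hs with hm
    have h1 : Finsupp.linearCombination R β l m = l m * b m m := by
      rw [Finsupp.linearCombination_apply, Finsupp.sum, Finsupp.finsetSum_apply,
        Finset.sum_eq_single m]
      · rfl
      · intro i hi him
        have : i < m := lt_of_le_of_ne (Finset.le_max' _ _ hi) him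
        have h0 : b i m = 0 := (hb i).2 m this
        simp [β, h0]
      · intro h
        exact absurd (Finset.max'_mem _ hs) h
    rw [hl] at h1
    exact mul_ne_zero (Finsupp.mem_support_iff.1 (Finset.max'_mem _ hs)) m.2 h1.symm
  have hsupp : ∀ v ∈ N, v ≠ 0 → ∃ i, v i ≠ 0 ∧ v ∈ V i := by
    intro v hv h0
    have hs : v.support.Nonempty := Finsupp.support_nonempty_iff.2 h0
    refine ⟨v.support.max' hs, Finsupp.mem_support_iff.1 (Finset.max'_mem _ hs), hv, fun j hj => ?_⟩
    by_contra h
    exact absurd (Finset.le_max' _ _ (Finsupp.mem_support_iff.2 h)) (not_le.2 hj)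
  have hspan : ∀ i, ∀ v ∈ V i, v ∈ Submodule.span R (Set.range β) := by
    intro i
    induction i using WellFoundedLT.induction with
    | ind i ih =>
      -- Once a multiple of `b i` has cancelled coordinate `i`, the leading index drops and
      -- well-foundedness applies.
      have aux : ∀ v ∈ N, (∀ j, i ≤ j → v j = 0) → v ∈ Submodule.span R (Set.range β) := by
        intro v hv hvi
        by_cases h0 : v = 0
        · rw [h0]; exact Submodule.zero_mem _
        obtain ⟨j, hj, hvj⟩ := hsupp v hv h0
        exact ih j (not_le.1 fun h => hj (hvi _ h)) v hvj
      intro v hv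
      obtain ⟨c, hc⟩ := hdiv i v hv
      by_cases hd : b i i = 0
      · refine aux v hv.1 fun j hj => ?_
        rcases hj.eq_or_lt with rfl | hj
        · rw [hc, hd, mul_zero]
        · exact hv.2 j hj
      · rw [← sub_add_cancel v (c • b i)]
        refine Submodule.add_mem _ (aux _ (N.sub_mem hv.1 (N.smul_mem c (hb i).1)) fun j hj => ?_)
          (Submodule.smul_mem _ _ (Submodule.subset_span ⟨⟨i, hd⟩, rfl⟩))
        rw [Finsupp.sub_apply, Finsupp.smul_apply]
        rcases hj.eq_or_lt with rfl | hj
        · rw [hc, smul_eq_mul, sub_self]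
        · rw [hv.2 j hj, (hb i).2 j hj, smul_zero, sub_self]
  have hN : N = Submodule.span R (Set.range β) := by
    refine le_antisymm (fun v hv => ?_) (Submodule.span_le.2 ?_)
    · by_cases h0 : v = 0
      · rw [h0]; exact Submodule.zero_mem _
      obtain ⟨i, -, hi⟩ := hsupp v hv h0
      exact hspan i v hi
    · rintro _ ⟨i, rfl⟩
      exact (hb i).1
  rw [hN]
  exact Module.Free.of_basis (Module.Basis.span hli)

/-! ### Infinite rank of the intersections -/

namespace Thompson

/-- `ψ` gives freeness, as subgroups of free abelian groups are free; `χ` rules out finite rank,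
since ℤ is Noetherian. -/
theorem isFreeAbelianOfInfiniteRank_of_injective {H : Type} [Group H]
    (ψ : H →* Multiplicative (ℕ →₀ ℤ)) (hψ : Function.Injective ψ)
    (χ : Multiplicative (ℕ →₀ ℤ) →* H) (hχ : Function.Injective χ) :
    IsFreeAbelianOfInfiniteRank H := by
  let N : Submodule ℤ (ℕ →₀ ℤ) := (MonoidHom.toAdditiveLeft ψ).range.toIntSubmodule
  have := N.free_of_isPrincipalIdealRing
  let e₀ : H →* Multiplicative N :=
    MonoidHom.mk' (fun h => .ofAdd ⟨(ψ h).toAdd, .ofMul h, rfl⟩) fun g h => by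
      refine congrArg Multiplicative.ofAdd (Subtype.ext ?_)
      simp
  let e : H ≃* Multiplicative N := MulEquiv.ofBijective e₀
    ⟨fun g h hgh => hψ (Multiplicative.toAdd.injective
        (congrArg (fun v : Multiplicative N => (v.toAdd : ℕ →₀ ℤ)) hgh)),
      fun ⟨v, h, hv⟩ => ⟨h.toMul, Subtype.ext hv⟩⟩
  let b := Module.Free.chooseBasis ℤ N
  let e' : H ≃* Multiplicative (Module.Free.ChooseBasisIndex ℤ N →₀ ℤ) :=
    e.trans (AddEquiv.toMultiplicative b.repr.toAddEquiv)
  refine ⟨Module.Free.ChooseBasisIndex ℤ N, ?_, ⟨e'⟩⟩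
  by_contra hfin
  rw [not_infinite_iff_finite] at hfin
  let f : (ℕ →₀ ℤ) →ₗ[ℤ] (Module.Free.ChooseBasisIndex ℤ N →₀ ℤ) :=
    (AddMonoidHom.toMultiplicative.symm (e'.toMonoidHom.comp χ)).toIntLinearMap
  have hf : Function.Injective f := fun v w h =>
    Multiplicative.ofAdd.injective (hχ (e'.injective h))
  have : Module.Finite ℤ (ℕ →₀ ℤ) := Module.Finite.of_injective f hf
  have : Finite ℕ := Module.Finite.finite_basis (Finsupp.basisSingleOne (R := ℤ) (ι := ℕ))
  exact not_finite ℕ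

theorem isFreeAbelianOfInfiniteRank_of_mem_family {H : Subgroup F} (hH : H ∈ family) :
    IsFreeAbelianOfInfiniteRank H := by
  obtain ⟨X, ⟨g, hg⟩, hX, rfl⟩ := hH
  obtain ⟨m, hm⟩ := exists_Atail_le_iInf X hX
  have hle : ⨅ g ∈ X, conjugate A g ≤ conjugate A g := iInf₂_le g hg
  refine isFreeAbelianOfInfiniteRank_of_injective
    (aEquiv.symm.toMonoidHom.comp (MonoidHom.mk'
      (fun h : (⨅ g ∈ X, conjugate A g : Subgroup F) =>
        (⟨g * h * g⁻¹, mem_conjugate.1 (hle h.2)⟩ : A))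
      fun h h' => Subtype.ext (by simp [mul_assoc]))) ?_
    (((A.subtype.comp aHom).comp (shift m)).codRestrict _ fun e => hm (aHom_shift_mem m e)) ?_
  · intro h h' hh
    have := congrArg Subtype.val (aEquiv.symm.injective hh)
    exact Subtype.ext (mul_left_cancel (mul_right_cancel this))
  · intro e e' h
    have h' : (aHom (shift m e) : F) = aHom (shift m e') := 
      congrArg (Subtype.val (p := (· ∈ ⨅ g ∈ X, conjugate A g))) h
    exact shift_injective m (aHom_injective (Subtype.ext h'))

end Thompson

/-! ### Vanishing of the cohomology of F -/

namespace Thompson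

instance : evenWords.Normal where
  conj_mem w hw g := by
    have hw' : Even (exponentSum w).toAdd := hw
    have h : exponentSum (g * w * g⁻¹) = exponentSum w := by
      rw [map_mul, map_mul, map_inv, mul_comm, inv_mul_cancel_left]
    change Even (exponentSum (g * w * g⁻¹)).toAdd
    rwa [h]

instance : F₀.Normal :=
  Subgroup.Normal.map inferInstance _ (PresentedGroup.mk_surjective relators)

theorem Atail_le_F₀ (m : ℕ) : Atail m ≤ F₀ := by
  refine (Subgroup.closure_le _).2 ?_
  rintro _ ⟨n, -, rfl⟩
  refine ⟨FreeGroup.of (2 * n + 1) * (FreeGroup.of (2 * n))⁻¹, ?_, by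
    rw [map_mul, map_inv]; rfl⟩
  change Even (exponentSum _).toAdd
  simp [exponentSum]

/-- The commutative subgroups of `F₀` which contain some `A_m`. -/
def commutativeFamily : Set (Subgroup F₀) :=
  {K | (∀ g ∈ K, ∀ h ∈ K, g * h = h * g) ∧ ∃ m, Atail m ≤ K.map F₀.subtype}

/-- The stabilizer of the coset of g is gAg⁻¹ ∩ `F₀`: commutative like `A`, and containing a tail
because g⁻¹ ∈ `F₀`. -/
theorem stabilizer_mem_commutativeFamily (y : F₀ ⧸ A.subgroupOf F₀) :
    MulAction.stabilizer F₀ y ∈ commutativeFamily := by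
  induction y using QuotientGroup.induction_on with
  | H g =>
    have hmem : ∀ h : F₀, h ∈ MulAction.stabilizer F₀ (g : F₀ ⧸ A.subgroupOf F₀) ↔
        (g : F)⁻¹ * h * g ∈ A := by
      intro h
      rw [MulAction.mem_stabilizer_iff, eq_comm, MulAction.Quotient.smul_coe, QuotientGroup.eq,
        Subgroup.mem_subgroupOf]
      simp [mul_assoc]
    constructor
    · intro h hh h' hh'
      have := setLike_mul_comm ((hmem h).1 hh) ((hmem h').1 hh')
      have h1 : (g : F)⁻¹ * (h * h') * g = (g : F)⁻¹ * (h' * h) * g := by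
        calc (g : F)⁻¹ * (h * h') * g = ((g : F)⁻¹ * h * g) * ((g : F)⁻¹ * h' * g) := by group
          _ = ((g : F)⁻¹ * h' * g) * ((g : F)⁻¹ * h * g) := this
          _ = (g : F)⁻¹ * (h' * h) * g := by group
      exact Subtype.ext (mul_left_cancel (mul_right_cancel h1))
    · obtain ⟨m, hm⟩ := exists_Atail_le_conjugate (g⁻¹).2
      refine ⟨m, fun y hy => ⟨⟨y, Atail_le_F₀ m hy⟩, (hmem _).2 ?_, rfl⟩⟩
      simpa using mem_conjugate.1 (hm hy)

theorem inf_stabilizer_mem_commutativeFamily {K : Subgroup F₀} (hK : K ∈ commutativeFamily)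
    (y : F₀ ⧸ A.subgroupOf F₀) : K ⊓ MulAction.stabilizer F₀ y ∈ commutativeFamily := by
  obtain ⟨hc, m, hm⟩ := hK
  obtain ⟨-, l, hl⟩ := stabilizer_mem_commutativeFamily y
  refine ⟨fun g hg h hh => hc g hg.1 h hh.1, max m l, ?_⟩
  rw [Subgroup.map_inf_eq _ _ _ F₀.subtype_injective]
  exact le_inf ((Atail_antitone (le_max_left m l)).trans hm)
    ((Atail_antitone (le_max_right m l)).trans hl)

open Rep in
theorem subsingleton_groupCohomology_of_mem_commutativeFamily {K : Subgroup F₀}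
    (hK : K ∈ commutativeFamily) (n : ℕ) :
    Subsingleton (groupCohomology
      (res K.subtype (res F₀.subtype (leftRegular ℤ F))) n) := by
  obtain ⟨hc, m, hm⟩ := hK
  have hF (e) : (aHom (shift m e) : F) ∈ F₀ := Atail_le_F₀ m (aHom_shift_mem m e)
  let φ : Multiplicative (ℕ →₀ ℤ) →* K :=
    (((A.subtype.comp aHom).comp (shift m)).codRestrict F₀ hF).codRestrict K fun e => by
      obtain ⟨g, hg, hge⟩ := hm (aHom_shift_mem m e)
      have h : g = ((A.subtype.comp aHom).comp (shift m)).codRestrict F₀ hF e := Subtype.ext hge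
      exact h ▸ hg
  have := groupCohomology.subsingleton_permutation φ
    (fun e => Subgroup.mem_center_iff.2 fun g => Subtype.ext (hc g g.2 _ (φ e).2)) F
    (fun y e he => by
      have h1 : (aHom (shift m e) : F) * y = y := he
      have h2 : aHom (shift m e) = 1 := Subtype.ext (mul_eq_right.1 h1)
      exact shift_injective m (aHom_injective (h2.trans (by simp)))) n
  exact groupCohomology.subsingleton_of_iso
    (permutationIsoResOfMulAction ℤ (F₀.subtype.comp K.subtype) F fun _ _ => rfl) n

-- Two passes are made because the tail argument needs conjugators in `F₀`. The first uses F/`F₀`,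
-- whose stabilizers all equal `F₀` by normality; the second uses the cosets of `A` in `F₀`.
open Rep in
theorem subsingleton_groupCohomology_leftRegular (n : ℕ) :
    Subsingleton (groupCohomology (leftRegular ℤ F) n) := by
  have hstab : ∀ y : F ⧸ F₀, MulAction.stabilizer F y = F₀ := by
    intro y
    induction y using QuotientGroup.induction_on with
    | H g =>
      ext h
      rw [MulAction.mem_stabilizer_iff, eq_comm, MulAction.Quotient.smul_coe, QuotientGroup.eq,
        smul_eq_mul, ← mul_assoc, ← (inferInstance : F₀.Normal).mem_comm_iff, mul_inv_cancel_left]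
  refine groupCohomology.subsingleton_of_stabilizers (F ⧸ F₀) {F₀} hstab ?_ _ ?_ n
  · rintro _ rfl y
    rw [hstab y, inf_idem]
    rfl
  · rintro _ rfl n
    exact groupCohomology.subsingleton_of_stabilizers (F₀ ⧸ A.subgroupOf F₀) commutativeFamily
      stabilizer_mem_commutativeFamily (fun _ hK y => inf_stabilizer_mem_commutativeFamily hK y) _
      (fun _ hK n => subsingleton_groupCohomology_of_mem_commutativeFamily hK n) n

end Thompson

theorem mainTheorem6 :
    -- the elements `x₂ₙ₊₁ x₂ₙ⁻¹` are distinct and `A` is free abelian on them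
    (Function.Injective Thompson.a ∧
      ∃ e : Multiplicative (ℕ →₀ ℤ) ≃* Thompson.A,
        ∀ n : ℕ, (e (Multiplicative.ofAdd (Finsupp.single n 1)) : Thompson.F) = Thompson.a n) ∧
    -- finite intersections of conjugates of `A` by elements of `F₀` contain some `A_m`
    (∀ X : Finset Thompson.F, (∀ g ∈ X, g ∈ Thompson.F₀) →
      ∃ m : ℕ, Thompson.Atail m ≤ ⨅ g ∈ X, Thompson.conjugate Thompson.A g) ∧
    -- every member of the family is free abelian of infinite rank
    (∀ H ∈ Thompson.family, Thompson.IsFreeAbelianOfInfiniteRank H) ∧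
    -- `H^n(F, ℤF) = 0` for every `n`
    (∀ n : ℕ, Subsingleton (groupCohomology (Rep.leftRegular ℤ Thompson.F) n)) :=
  ⟨⟨Thompson.a_injective, Thompson.aEquiv, Thompson.aEquiv_single⟩,
    Thompson.exists_Atail_le_iInf,
    fun _ hH => Thompson.isFreeAbelianOfInfiniteRank_of_mem_family hH,
    Thompson.subsingleton_groupCohomology_leftRegular⟩
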